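/- Let $n, k, d$ be positive integers with $k > d \ge 2$ and $n \ge 2k+2d-3$, and let $\mathcal{F}$ be an intersecting family of $k$-element subsets of $[n]=\{1,\dots,n\}$, i.e. $A\cap B\neq\emptyset$ for all $A,B\in\mathcal{F}$. For $S\subseteq[n]$ let $d_S(\mathcal{F})=|\{T\in\mathcal{F}: S\subseteq T\}|$, and let $\delta_d(\mathcal{F})=\min\{d_S(\mathcal{F}): S\subseteq[n],\ |S|=d\}$ be the minimum $d$-degree of $\mathcal{F}$. Then $$\delta_d(\mathcal{F})\le\binom{n-d-1}{k-d-1}.$$ That is, some $d$-element subset of $[n]$ is contained in at most $\binom{n-d-1}{k-d-1}$ members of $\mathcal{F}$. In particular, for $d=2$ the bound holds for all $n\ge 2k+1$. -/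

import Mathlib

/-- The `S`-degree of a family `F` of subsets of an `n`-element set: the number of members of `F`
that contain `S`. -/
def setDegree {n : ℕ} (F : Finset (Finset (Fin n))) (S : Finset (Fin n)) : ℕ :=
  (F.filter (fun T => S ⊆ T)).card

/-- The minimum `d`-degree of `F`: the minimum of the `S`-degrees over all `S` of size `d`
(such `S` exist whenever `d ≤ n`, see `isLeast_minDegree`). -/
noncomputable def minDegree {n : ℕ} (d : ℕ) (F : Finset (Finset (Fin n))) : ℕ :=
  sInf {m : ℕ | ∃ S : Finset (Fin n), S.card = d ∧ setDegree F S = m}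

/-- For `d ≤ n` the minimum in the definition of `minDegree` is a genuine, attained minimum. -/
theorem isLeast_minDegree {n d : ℕ} (hdn : d ≤ n) (F : Finset (Finset (Fin n))) :
    IsLeast {m : ℕ | ∃ S : Finset (Fin n), S.card = d ∧ setDegree F S = m} (minDegree d F) := by
  have hne : {m : ℕ | ∃ S : Finset (Fin n), S.card = d ∧ setDegree F S = m}.Nonempty := by
    obtain ⟨S, -, hS⟩ := Finset.exists_subset_card_eq
      (s := (Finset.univ : Finset (Fin n))) (n := d) (by simpa using hdn)
    exact ⟨_, S, hS, rfl⟩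
  exact ⟨Nat.sInf_mem hne, fun m hm => Nat.sInf_le hm⟩

/-!
On the functions on `k`-element subsets of an `n`-element set, let `A f` average `f` over the
`k`-sets disjoint from a given one, and let `B f` average over the `d`-sets `S` disjoint from it
the mean of `f` on the `k`-sets containing `S`, its normalized `S`-degree. The space of functions
is the orthogonal sum of the lifts of the harmonic functions of levels `0, …, k`. On the `i`-th
summand `B` is the scalar `(-1)^i·d(d-1)⋯(d-i+1)/((n-d)(n-d-1)⋯(n-d-i+1))`, and `A` is the case
`d = k` of `B`. Comparing these eigenvalues gives `⟪f, (n - d) B f - (n - k) A f⟫ ≤ (k - d) ‖f‖²`.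
If `f` is the indicator of an intersecting family, then `A f` vanishes on the family, so
`B f T ≤ (k - d) / (n - d)` for some member `T`, and some `d`-set disjoint from `T` has normalized
degree at most `(k - d) / (n - d) = (n-d-1).choose (k-d-1) / (n-d).choose (k-d)`.
-/

section FactorialIdentities

theorem choose_sub_mul_descFactorial {a b i : ℕ} (hib : i ≤ b) :
    (a - i).choose (b - i) * a.descFactorial i = a.choose b * b.descFactorial i := by
  rw [Nat.descFactorial_eq_factorial_mul_choose, Nat.descFactorial_eq_factorial_mul_choose,
    mul_left_comm, mul_left_comm (a.choose b), Nat.choose_mul hib, mul_comm (a.choose i)]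

theorem choose_mul_sub {n k d : ℕ} (hdk : d < k) (hkn : k ≤ n) :
    ((n - d).choose (k - d) : ℝ) * (k - d) = (n - d - 1).choose (k - d - 1) * (n - d) := by
  have h := Nat.add_one_mul_choose_eq (n - d - 1) (k - d - 1)
  rw [show n - d - 1 + 1 = n - d by omega, show k - d - 1 + 1 = k - d by omega] at h
  rw [← Nat.cast_sub hdk.le, ← Nat.cast_sub (hdk.le.trans hkn), mul_comm _ ((n - d : ℕ) : ℝ)]
  exact_mod_cast h.symm

theorem cast_descFactorial_succ (m i : ℕ) :
    (m.descFactorial (i + 1) : ℝ) = (m - i) * m.descFactorial i := by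
  rw [Nat.descFactorial_succ, Nat.cast_mul]
  rcases le_or_gt i m with him | hmi
  · rw [Nat.cast_sub him]
  · simp [Nat.descFactorial_eq_zero_iff_lt.2 hmi]

theorem descFactorial_succ_eq_mul_pred (m i : ℕ) :
    m.descFactorial (i + 1) = m * (m - 1).descFactorial i := by
  cases m with
  | zero => simp
  | succ m => rw [Nat.succ_descFactorial_succ, Nat.add_sub_cancel]

end FactorialIdentities

section KneserRatio

/-- Up to the sign `(-1) ^ i`, the eigenvalue of `disjointMean k m` on the `i`-th harmonic level of
the functions on subsets of an `n`-element set; only `m ≤ n` is meaningful, as `n - m` is truncated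
subtraction. -/
noncomputable def kneserRatio (n m i : ℕ) : ℝ :=
  m.descFactorial i / (n - m).descFactorial i

theorem kneserRatio_zero (n m : ℕ) : kneserRatio n m 0 = 1 := by
  simp [kneserRatio]

theorem sub_mul_kneserRatio_succ {n m : ℕ} (hm : m < n) (i : ℕ) :
    ((n : ℝ) - m) * kneserRatio n m (i + 1) =
      m.descFactorial (i + 1) / (n - m - 1).descFactorial i := by
  have hnm : (n : ℝ) - m ≠ 0 := sub_ne_zero.2 (by exact_mod_cast hm.ne')
  rw [kneserRatio, descFactorial_succ_eq_mul_pred (n - m), Nat.cast_mul, Nat.cast_sub hm.le,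
    mul_div_assoc', mul_div_mul_left _ _ hnm]

theorem sub_mul_kneserRatio_one {n m : ℕ} (hm : m < n) :
    ((n : ℝ) - m) * kneserRatio n m 1 = m := by
  simpa using sub_mul_kneserRatio_succ hm 0

theorem sub_mul_kneserRatio_succ_le {n k d i : ℕ} (hdk : d ≤ k) (hi : k + i < n) :
    ((n : ℝ) - d) * kneserRatio n d (i + 1) ≤ (n - k) * kneserRatio n k (i + 1) := by
  rw [sub_mul_kneserRatio_succ (by omega), sub_mul_kneserRatio_succ (by omega)]
  have hpos : 0 < (n - k - 1).descFactorial i := Nat.descFactorial_pos.2 (by omega)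
  gcongr

theorem sub_mul_kneserRatio_sub_add_two {n m i : ℕ} (hi : m + i + 2 < n) :
    ((n : ℝ) - m) * kneserRatio n m (i + 1) - (n - m) * kneserRatio n m (i + 3) =
      (n - 2 * i - 3) *
        ((n - 2 * m) * (m.descFactorial (i + 1) / (n - m - 1).descFactorial (i + 2))) := by
  rw [sub_mul_kneserRatio_succ (by omega), sub_mul_kneserRatio_succ (by omega)]
  have hne (j : ℕ) (hj : j ≤ i + 2) : ((n - m - 1).descFactorial j : ℝ) ≠ 0 :=
    Nat.cast_ne_zero.2 (Nat.descFactorial_pos.2 (by omega)).ne'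
  have hcast : ((n - m - 1 : ℕ) : ℝ) = n - m - 1 := by
    rw [Nat.cast_sub (by omega), Nat.cast_sub (by omega), Nat.cast_one]
  have h₀ := hne i (by omega)
  have h₂ := hne (i + 2) le_rfl
  have hsucc : ((n - m - 1).descFactorial (i + 2) : ℝ) =
      (n - m - 1 - (i + 1)) * ((n - m - 1 - i) * (n - m - 1).descFactorial i) := by
    rw [cast_descFactorial_succ _ (i + 1), cast_descFactorial_succ, hcast, Nat.cast_succ]
  rw [div_sub_div _ _ h₀ h₂, mul_div_assoc', mul_div_assoc', div_eq_div_iff (mul_ne_zero h₀ h₂) h₂,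
    cast_descFactorial_succ m (i + 2), cast_descFactorial_succ m (i + 1), hsucc]
  push_cast
  ring

theorem mul_sub_two_mul_le {n k d : ℕ} (hdk : d < k) (hk : 2 * k < n)
    (hd : 2 * k + 2 * d ≤ n + 3) :
    (d : ℝ) * (n - 2 * d) * ((n - k - 1) * (n - k - 2)) ≤
      k * (n - 2 * k) * ((n - d - 1) * (n - d - 2)) := by
  obtain ⟨x, rfl⟩ := Nat.exists_eq_add_of_lt hdk
  rw [← sub_nonneg]
  -- In the slack variables of the hypotheses, the difference has nonnegative coefficients.
  rcases d with _ | _ | y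
  · obtain ⟨z, rfl⟩ := Nat.exists_eq_add_of_lt hk
    push_cast
    ring_nf
    positivity
  · obtain ⟨z, rfl⟩ := Nat.exists_eq_add_of_lt hk
    push_cast
    ring_nf
    positivity
  · obtain ⟨z, rfl⟩ : ∃ z, n = 4 * y + 7 + 2 * x + z := Nat.exists_eq_add_of_le (by omega)
    push_cast
    ring_nf
    positivity

theorem sub_two_mul_mul_descFactorial_div {n m i : ℕ} (hm : m + 3 ≤ n) :
    ((n : ℝ) - 2 * m) * (m.descFactorial (i + 1) / (n - m - 1).descFactorial (i + 2)) =
      m * (n - 2 * m) / ((n - m - 1) * (n - m - 2)) *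
        ((m - 1).descFactorial i / (n - m - 3).descFactorial i) := by
  have h₁ : ((n - m - 1 : ℕ) : ℝ) = n - m - 1 := by
    rw [Nat.cast_sub (by omega), Nat.cast_sub (by omega), Nat.cast_one]
  have h₂ : ((n - m - 1 - 1 : ℕ) : ℝ) = n - m - 2 := by
    rw [Nat.cast_sub (by omega), h₁, Nat.cast_one]
    ring
  rw [descFactorial_succ_eq_mul_pred m, descFactorial_succ_eq_mul_pred (n - m - 1),
    descFactorial_succ_eq_mul_pred (n - m - 1 - 1), show n - m - 1 - 1 - 1 = n - m - 3 by omega]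
  push_cast
  rw [h₁, h₂, div_mul_div_comm, mul_div_assoc']
  congr 1 <;> ring

theorem sub_two_mul_mul_descFactorial_div_le {n k d i : ℕ} (hdk : d < k) (hk : 2 * k < n)
    (hd : 2 * k + 2 * d ≤ n + 3) (hi : k + i + 2 < n) :
    ((n : ℝ) - 2 * d) * (d.descFactorial (i + 1) / (n - d - 1).descFactorial (i + 2)) ≤
      (n - 2 * k) * (k.descFactorial (i + 1) / (n - k - 1).descFactorial (i + 2)) := by
  have hdkR : (d : ℝ) < k := by exact_mod_cast hdk
  have hkR : 2 * (k : ℝ) < n := by exact_mod_cast hk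
  have hkn : (k : ℝ) + 3 ≤ n := by exact_mod_cast (by omega : k + 3 ≤ n)
  rw [sub_two_mul_mul_descFactorial_div (by omega), sub_two_mul_mul_descFactorial_div (by omega)]
  have hbase : (d : ℝ) * (n - 2 * d) / ((n - d - 1) * (n - d - 2)) ≤
      k * (n - 2 * k) / ((n - k - 1) * (n - k - 2)) := by
    rw [div_le_div_iff₀ (mul_pos (by linarith) (by linarith))
      (mul_pos (by linarith) (by linarith))]
    exact mul_sub_two_mul_le hdk hk hd
  have hpos : 0 < (n - k - 3).descFactorial i := Nat.descFactorial_pos.2 (by omega)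
  refine mul_le_mul hbase ?_ (by positivity) ?_
  · gcongr
  · exact div_nonneg (mul_nonneg (by positivity) (by linarith))
      (mul_nonneg (by linarith) (by linarith))

theorem sub_mul_kneserRatio_odd_le {n k d : ℕ} (hdk : d < k) (hk : 2 * k < n)
    (hd : 2 * k + 2 * d ≤ n + 3) {j : ℕ} (hj : 2 * j + 1 ≤ k) :
    ((n : ℝ) - k) * kneserRatio n k (2 * j + 1) - (n - d) * kneserRatio n d (2 * j + 1) ≤
      k - d := by
  -- From level `i` to level `i + 2`, the term of `k` decreases by at least as much as that of `d`.
  induction j with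
  | zero => simp [sub_mul_kneserRatio_one (show d < n by omega),
      sub_mul_kneserRatio_one (show k < n by omega)]
  | succ j ih =>
    have hdecr_d := sub_mul_kneserRatio_sub_add_two (n := n) (m := d) (i := 2 * j) (by omega)
    have hdecr_k := sub_mul_kneserRatio_sub_add_two (n := n) (m := k) (i := 2 * j) (by omega)
    have hn : (0 : ℝ) ≤ n - 2 * (2 * j : ℕ) - 3 := by
      have : 2 * (2 * j : ℕ) + (3 : ℝ) ≤ n := by
        exact_mod_cast (by omega : 2 * (2 * j) + 3 ≤ n)
      linarith
    have hle := mul_le_mul_of_nonneg_left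
      (sub_two_mul_mul_descFactorial_div_le hdk hk hd (i := 2 * j) (by omega)) hn
    rw [show 2 * (j + 1) + 1 = 2 * j + 3 by ring]
    linarith [ih (by omega)]

theorem neg_one_pow_mul_kneserRatio_sub_le {n k d i : ℕ} (hdk : d < k) (hk : 2 * k < n)
    (hd : 2 * k + 2 * d ≤ n + 3) (hi : i ≤ k) :
    (-1) ^ i * (((n : ℝ) - d) * kneserRatio n d i - (n - k) * kneserRatio n k i) ≤ k - d := by
  rcases i.even_or_odd' with ⟨j, rfl | rfl⟩
  · rw [(even_two_mul j).neg_one_pow, one_mul]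
    rcases j with _ | j
    · simp [kneserRatio_zero]
    · have hmono := sub_mul_kneserRatio_succ_le (n := n) hdk.le (i := 2 * j + 1) (by omega)
      have hdkR : (d : ℝ) ≤ k := by exact_mod_cast hdk.le
      rw [show 2 * (j + 1) = 2 * j + 1 + 1 by ring]
      linarith
  · rw [(odd_two_mul_add_one j).neg_one_pow]
    linarith [sub_mul_kneserRatio_odd_le hdk hk hd hi]

end KneserRatio

section LevelSum

open Finset
open scoped BigOperators

variable {α : Type*}

/-- The sum of `h` over the `i`-element subsets of `T`. As a function of `T`, this is how `h`,
regarded as a function on `i`-element sets, is lifted to a function on larger sets. -/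
def levelSum (i : ℕ) (h : Finset α → ℝ) (T : Finset α) : ℝ :=
  ∑ I ∈ T.powersetCard i, h I

theorem levelSum_eq_zero_of_card_lt {i : ℕ} {T : Finset α} (hT : #T < i) (h : Finset α → ℝ) :
    levelSum i h T = 0 := by
  rw [levelSum, powersetCard_eq_empty.2 hT, sum_empty]

theorem expect_powersetCard_levelSum {d : ℕ} {A : Finset α} (hd : d ≤ #A) (i : ℕ)
    (h : Finset α → ℝ) :
    𝔼 S ∈ A.powersetCard d, levelSum i h S =
      d.descFactorial i / (#A).descFactorial i * levelSum i h A := by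
  classical
  rcases lt_or_ge d i with hdi | hid
  · rw [Nat.descFactorial_eq_zero_iff_lt.2 hdi, Nat.cast_zero, zero_div, zero_mul]
    refine expect_eq_zero fun S hS => levelSum_eq_zero_of_card_lt ?_ h
    rwa [(mem_powersetCard.1 hS).2]
  have hcomm : ∑ S ∈ A.powersetCard d, levelSum i h S =
      ∑ I ∈ A.powersetCard i, ∑ _S ∈ {S ∈ A.powersetCard d | I ⊆ S}, h I :=
    sum_comm' fun S I => by
      simp only [mem_powersetCard, mem_filter]
      exact ⟨fun ⟨⟨hSA, hS⟩, hIS, hI⟩ => ⟨⟨⟨hSA, hS⟩, hIS⟩, hIS.trans hSA, hI⟩,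
        fun ⟨⟨hS, hIS⟩, _, hI⟩ => ⟨hS, hIS, hI⟩⟩
  have hcount : ∀ I ∈ A.powersetCard i, ∑ _S ∈ {S ∈ A.powersetCard d | I ⊆ S}, h I =
      (#A - i).choose (d - i) * h I := by
    intro I hI
    obtain ⟨hIA, rfl⟩ := mem_powersetCard.1 hI
    rw [sum_const, nsmul_eq_mul, card_filter_powersetCard_subset _ _ _ hIA hid]
  have hne₁ : ((#A).choose d : ℝ) ≠ 0 := Nat.cast_ne_zero.2 (Nat.choose_pos hd).ne'
  have hne₂ : ((#A).descFactorial i : ℝ) ≠ 0 :=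
    Nat.cast_ne_zero.2 (Nat.descFactorial_pos.2 (hid.trans hd)).ne'
  rw [expect_eq_sum_div_card, hcomm, sum_congr rfl hcount, ← mul_sum, card_powersetCard,
    ← levelSum, mul_div_right_comm]
  congr 1
  rw [div_eq_div_iff hne₁ hne₂, mul_comm (d.descFactorial i : ℝ)]
  exact_mod_cast choose_sub_mul_descFactorial hid

variable [DecidableEq α]

theorem sum_levelSum_erase (i : ℕ) (h : Finset α → ℝ) (T : Finset α) :
    ∑ x ∈ T, levelSum i h (T.erase x) = ((#T : ℝ) - i) * levelSum i h T := by
  have hcomm : ∑ x ∈ T, levelSum i h (T.erase x) = ∑ I ∈ T.powersetCard i, ∑ _x ∈ T \ I, h I :=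
    sum_comm' fun x I => by
      simp only [mem_powersetCard, mem_sdiff, subset_erase]
      tauto
  rw [hcomm, levelSum, mul_sum]
  refine sum_congr rfl fun I hI => ?_
  obtain ⟨hIT, rfl⟩ := mem_powersetCard.1 hI
  rw [sum_const, nsmul_eq_mul, cast_card_sdiff hIT]

variable [Fintype α]

theorem sum_sum_erase {M : Type*} [AddCommMonoid M] (φ : Finset α → α → M) :
    ∑ I, ∑ x ∈ I, φ (I.erase x) x = ∑ J, ∑ x ∈ Jᶜ, φ J x := by
  rw [sum_sigma', sum_sigma']
  refine sum_bij' (fun p _ => ⟨p.1.erase p.2, p.2⟩) (fun p _ => ⟨insert p.2 p.1, p.2⟩)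
    ?_ ?_ ?_ ?_ ?_ <;> rintro ⟨I, x⟩ hx <;>
    simp only [mem_sigma, mem_univ, true_and, mem_compl] at hx <;> simp [hx]

theorem levelSum_eq_sum_mul_prod (i : ℕ) (h : Finset α → ℝ) (T : Finset α) :
    levelSum i h T =
      ∑ I ∈ univ.powersetCard i, h I * ∏ x ∈ I, if x ∈ T then (1 : ℝ) else 0 := by
  simp only [prod_boole, mul_ite, mul_one, mul_zero]
  rw [← sum_filter, levelSum]
  congr 1
  ext I
  simp [mem_powersetCard, subset_iff, and_comm]

/-- A function on finite sets is harmonic if its sum over the one-point extensions of any set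
vanishes. There is no condition on the cardinality of that set, so that one function can be used on
every level. Restricted to `i`-element sets, the harmonic functions form the kernel of the lowering
operator of the Boolean lattice, the `i`-th isotypic component of the Johnson scheme. -/
def IsHarmonic (h : Finset α → ℝ) : Prop :=
  ∀ J : Finset α, ∑ x ∈ Jᶜ, h (insert x J) = 0

namespace IsHarmonic

variable {h : Finset α → ℝ}

theorem const_mul (hh : IsHarmonic h) (c : ℝ) : IsHarmonic fun I => c * h I := fun J => by
  rw [← mul_sum, hh J, mul_zero]

theorem sum_mul_sum_prod_erase (hh : IsHarmonic h) (i : ℕ) (w : α → ℝ) :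
    ∑ I ∈ univ.powersetCard i, h I * ∑ x ∈ I, ∏ y ∈ I.erase x, w y = 0 := calc
  _ = ∑ I, ∑ x ∈ I, if #(I.erase x) + 1 = i then
        h (insert x (I.erase x)) * ∏ y ∈ I.erase x, w y else 0 := by
    rw [powersetCard_eq_filter, powerset_univ, sum_filter]
    refine sum_congr rfl fun I _ => ?_
    trans ∑ x ∈ I, if #I = i then h I * ∏ y ∈ I.erase x, w y else 0
    · rw [sum_ite_irrel, sum_const_zero, mul_sum]
    · refine sum_congr rfl fun x hx => ?_
      rw [insert_erase hx, card_erase_add_one hx]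
  _ = ∑ J, ∑ x ∈ Jᶜ, if #J + 1 = i then h (insert x J) * ∏ y ∈ J, w y else 0 :=
    sum_sum_erase fun J x => if #J + 1 = i then h (insert x J) * ∏ y ∈ J, w y else 0
  _ = 0 := sum_eq_zero fun J _ => by
    split_ifs
    · rw [← sum_mul, hh J, zero_mul]
    · exact sum_const_zero

theorem sum_mul_prod_add (hh : IsHarmonic h) (i : ℕ) (v : α → ℝ) (t : ℝ) :
    ∑ I ∈ univ.powersetCard i, h I * ∏ x ∈ I, (v x + t) =
      ∑ I ∈ univ.powersetCard i, h I * ∏ x ∈ I, v x := by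
  have hderiv (t : ℝ) :
      HasDerivAt (fun t => ∑ I ∈ univ.powersetCard i, h I * ∏ x ∈ I, (v x + t)) 0 t := by
    have hprod (I : Finset α) : HasDerivAt (fun t => ∏ x ∈ I, (v x + t))
        (∑ x ∈ I, ∏ y ∈ I.erase x, (v y + t)) t := by
      simpa using HasDerivAt.fun_finsetProd fun x (_ : x ∈ I) => (hasDerivAt_id t).const_add (v x)
    rw [← hh.sum_mul_sum_prod_erase i fun x => v x + t]
    exact HasDerivAt.fun_sum fun I _ => (hprod I).const_mul (h I)
  simpa using is_const_of_deriv_eq_zero (fun t => (hderiv t).differentiableAt)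
    (fun t => (hderiv t).deriv) t 0

-- The indicator of `Tᶜ` is the translate by `1` of minus the indicator of `T`.
theorem levelSum_compl (hh : IsHarmonic h) (i : ℕ) (T : Finset α) :
    levelSum i h Tᶜ = (-1) ^ i * levelSum i h T := by
  have hcompl (x : α) : (if x ∈ Tᶜ then (1 : ℝ) else 0) = -(if x ∈ T then 1 else 0) + 1 := by
    by_cases hx : x ∈ T <;> simp [hx]
  simp only [levelSum_eq_sum_mul_prod, hcompl]
  rw [hh.sum_mul_prod_add i (fun x => -(if x ∈ T then 1 else 0)), mul_sum]
  refine sum_congr rfl fun I hI => ?_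
  rw [prod_neg, (mem_powersetCard.1 hI).2, mul_left_comm]

end IsHarmonic



end LevelSum

section Averages

open Finset
open scoped BigOperators

variable {α : Type*} [Fintype α] [DecidableEq α]

/-- The average of `f` over the `k`-element supersets of `S`. For the indicator of a `k`-uniform
family this is the degree of `S` divided by its largest possible value. -/
noncomputable def supersetMean (k : ℕ) (f : Finset α → ℝ) (S : Finset α) : ℝ :=
  𝔼 R ∈ univ.powersetCard k with S ⊆ R, f R

/-- The average of `supersetMean k f` over the `d`-element sets disjoint from `T`. On functions
of `k`-element sets, `disjointMean k k` is the normalized adjacency operator of the Kneser graph. -/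
noncomputable def disjointMean (k d : ℕ) (f : Finset α → ℝ) (T : Finset α) : ℝ :=
  𝔼 S ∈ Tᶜ.powersetCard d, supersetMean k f S

theorem disjointMean_eq_sum {ι : Type*} {s : Finset ι} {k : ℕ} {f : Finset α → ℝ}
    {u : ι → Finset α → ℝ} (hf : ∀ T, #T = k → f T = ∑ i ∈ s, u i T) (d : ℕ) (T : Finset α) :
    disjointMean k d f T = ∑ i ∈ s, disjointMean k d (u i) T := by
  have hsuper (S : Finset α) : supersetMean k f S = ∑ i ∈ s, supersetMean k (u i) S := by
    simp only [supersetMean]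
    rw [← expect_sum_comm]
    exact expect_congr rfl fun R hR => hf R (mem_powersetCard_univ.1 (mem_filter.1 hR).1)
  simp only [disjointMean, hsuper]
  exact expect_sum_comm ..

theorem expect_powersetCard_superset (k : ℕ) (S : Finset α) (f : Finset α → ℝ)
    (hk : k ≤ Fintype.card α) :
    𝔼 R ∈ univ.powersetCard k with S ⊆ R, f R =
      𝔼 A ∈ Sᶜ.powersetCard (Fintype.card α - k), f Aᶜ := by
  refine expect_bij' (fun R _ => Rᶜ) (fun A _ => Aᶜ) ?_ ?_ ?_ ?_ ?_
  · intro R hR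
    simp only [mem_filter, mem_powersetCard_univ] at hR
    simp [mem_powersetCard, card_compl, hR.1, hR.2]
  · intro A hA
    obtain ⟨hAS, hA⟩ := mem_powersetCard.1 hA
    simp only [mem_filter, mem_powersetCard_univ, card_compl, hA]
    exact ⟨Nat.sub_sub_self hk, subset_compl_comm.1 hAS⟩
  all_goals simp

namespace IsHarmonic

variable {h : Finset α → ℝ}

theorem supersetMean_levelSum (hh : IsHarmonic h) {k : ℕ} {S : Finset α} (hS : #S ≤ k)
    (hk : k ≤ Fintype.card α) (i : ℕ) :
    supersetMean k (levelSum i h) S =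
      (Fintype.card α - k).descFactorial i / (Fintype.card α - #S).descFactorial i *
        levelSum i h S := by
  rw [supersetMean, expect_powersetCard_superset k S _ hk]
  simp only [hh.levelSum_compl]
  rw [← mul_expect, expect_powersetCard_levelSum (by rw [card_compl]; omega), hh.levelSum_compl,
    card_compl, mul_left_comm, ← mul_assoc ((-1) ^ i), ← mul_pow, neg_one_mul, neg_neg, one_pow,
    one_mul]

theorem disjointMean_levelSum (hh : IsHarmonic h) {k d i : ℕ} {T : Finset α} (hT : #T = k)
    (hdk : d ≤ k) (hik : i ≤ k) (hk : 2 * k ≤ Fintype.card α) :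
    disjointMean k d (levelSum i h) T =
      (-1) ^ i * kneserRatio (Fintype.card α) d i * levelSum i h T := by
  have hne : ((Fintype.card α - k).descFactorial i : ℝ) ≠ 0 :=
    Nat.cast_ne_zero.2 (Nat.descFactorial_pos.2 (by omega)).ne'
  have hmean : ∀ S ∈ Tᶜ.powersetCard d, supersetMean k (levelSum i h) S =
      (Fintype.card α - k).descFactorial i / (Fintype.card α - d).descFactorial i *
        levelSum i h S := by
    intro S hS
    have hSd := (mem_powersetCard.1 hS).2
    rw [hh.supersetMean_levelSum (by omega) (by omega), hSd]
  rw [disjointMean, expect_congr rfl hmean, ← mul_expect,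
    expect_powersetCard_levelSum (by rw [card_compl]; omega), hh.levelSum_compl, card_compl, hT,
    kneserRatio]
  field_simp

theorem sum_levelSum_mul_levelSum (hh : IsHarmonic h) {i j k : ℕ} (hij : i < j) (hik : i ≤ k)
    (hk : k ≤ Fintype.card α) (h' : Finset α → ℝ) :
    ∑ T ∈ univ.powersetCard k, levelSum i h' T * levelSum j h T = 0 := by
  have hcomm : ∑ T ∈ univ.powersetCard k, levelSum i h' T * levelSum j h T =
      ∑ I ∈ univ.powersetCard i, ∑ T ∈ univ.powersetCard k with I ⊆ T, h' I * levelSum j h T := by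
    simp only [levelSum, sum_mul]
    exact sum_comm' fun T I => by
      simp only [mem_powersetCard, mem_filter, subset_univ, true_and]
      tauto
  rw [hcomm]
  refine sum_eq_zero fun I hI => ?_
  have hIi := mem_powersetCard_univ.1 hI
  have hmean : supersetMean k (levelSum j h) I = 0 := by
    rw [hh.supersetMean_levelSum (by omega) hk, levelSum_eq_zero_of_card_lt (by omega), mul_zero]
  rw [← mul_sum, ← card_mul_expect, ← supersetMean, hmean, mul_zero, mul_zero]

end IsHarmonic

end Averages

section Decomposition

open Finset

variable {α : Type*} [Fintype α] [DecidableEq α]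

-- `h` is the component of `f` orthogonal to the range of the raising operator.
theorem exists_isHarmonic_add (f : Finset α → ℝ) : ∃ h g : Finset α → ℝ,
    IsHarmonic h ∧ ∀ T, f T = h T + ∑ x ∈ T, g (T.erase x) := by
  let raise : EuclideanSpace ℝ (Finset α) →ₗ[ℝ] EuclideanSpace ℝ (Finset α) :=
    { toFun := fun g => WithLp.toLp 2 fun T => ∑ x ∈ T, g (T.erase x)
      map_add' := fun a b => by ext T; simp [sum_add_distrib]
      map_smul' := fun c a => by ext T; simp [mul_sum] }
  obtain ⟨_, ⟨g, rfl⟩, h, hh, hf⟩ :=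
    (LinearMap.range raise).exists_add_mem_mem_orthogonal (WithLp.toLp 2 f)
  refine ⟨h, g, fun J => ?_, fun T => ?_⟩
  · calc
      ∑ x ∈ Jᶜ, h (insert x J) = ∑ J', ∑ x ∈ J'ᶜ, if J' = J then h (insert x J') else 0 := by
        simp only [sum_ite_irrel, sum_const_zero, sum_ite_eq', mem_univ, if_true]
      _ = ∑ T, ∑ x ∈ T, if T.erase x = J then h (insert x (T.erase x)) else 0 :=
        (sum_sum_erase fun J' x => if J' = J then h (insert x J') else 0).symm
      _ = inner ℝ (raise (EuclideanSpace.single J 1)) h := by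
        rw [PiLp.inner_apply]
        refine sum_congr rfl fun T _ => ?_
        simp only [raise, LinearMap.coe_mk, AddHom.coe_mk, PiLp.single_apply,
          RCLike.inner_apply, conj_trivial, mul_sum, mul_ite, mul_one, mul_zero]
        exact sum_congr rfl fun x hx => by rw [insert_erase hx]
      _ = 0 := hh _ ⟨_, rfl⟩
  · simpa [raise, add_comm] using congrArg (fun v : EuclideanSpace ℝ (Finset α) => v T) hf

theorem exists_sum_levelSum (k : ℕ) (f : Finset α → ℝ) :
    ∃ h : ℕ → Finset α → ℝ, (∀ i, IsHarmonic (h i)) ∧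
      ∀ T : Finset α, #T = k → f T = ∑ i ∈ range (k + 1), levelSum i (h i) T := by
  induction k generalizing f with
  | zero =>
    refine ⟨fun _ T => if T = ∅ then f ∅ else 0, fun i J => by simp, fun T hT => ?_⟩
    simp [levelSum, card_eq_zero.1 hT]
  | succ k ih =>
    obtain ⟨h₀, g, hh₀, hf⟩ := exists_isHarmonic_add f
    obtain ⟨h, hh, hg⟩ := ih g
    refine ⟨Function.update (fun i I => ((k + 1 : ℕ) - i : ℝ) * h i I) (k + 1) h₀,
      fun i => ?_, fun T hT => ?_⟩
    · rcases eq_or_ne i (k + 1) with rfl | hi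
      · rwa [Function.update_self]
      · rw [Function.update_of_ne hi]
        exact (hh i).const_mul _
    · have htop : levelSum (k + 1) h₀ T = h₀ T := by
        simp [levelSum, ← hT]
      have hlower : ∑ x ∈ T, g (T.erase x) =
          ∑ i ∈ range (k + 1), levelSum i (fun I => ((k + 1 : ℕ) - i : ℝ) * h i I) T := calc
        _ = ∑ x ∈ T, ∑ i ∈ range (k + 1), levelSum i (h i) (T.erase x) :=
          sum_congr rfl fun x hx => hg _ (by rw [card_erase_of_mem hx, hT, Nat.add_sub_cancel])
        _ = ∑ i ∈ range (k + 1), ((k + 1 : ℕ) - i) * levelSum i (h i) T := by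
          rw [sum_comm]
          simp only [sum_levelSum_erase, hT]
        _ = _ := by simp only [levelSum, mul_sum]
      rw [sum_range_succ, Function.update_self, htop, hf T, hlower, add_comm]
      congr 1
      exact sum_congr rfl fun i hi => by rw [Function.update_of_ne (mem_range.1 hi).ne]

theorem sum_mul_sum_mul_le_of_orthogonal {ι κ R : Type*} [CommRing R] [LinearOrder R]
    [IsStrictOrderedRing R] {s : Finset ι} {t : Finset κ} {u : κ → ι → R} {e : κ → R} {τ : R}
    (horth : ∀ i ∈ t, ∀ j ∈ t, i ≠ j → ∑ x ∈ s, u i x * u j x = 0)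
    (he : ∀ i ∈ t, e i ≤ τ) :
    ∑ x ∈ s, (∑ i ∈ t, u i x) * ∑ i ∈ t, e i * u i x ≤ τ * ∑ x ∈ s, (∑ i ∈ t, u i x) ^ 2 := by
  have hdiag (c : κ → R) : ∑ x ∈ s, (∑ i ∈ t, u i x) * ∑ i ∈ t, c i * u i x =
      ∑ i ∈ t, c i * ∑ x ∈ s, u i x ^ 2 := by
    simp only [sum_mul_sum]
    rw [sum_comm]
    refine sum_congr rfl fun i hi => ?_
    rw [sum_comm, sum_eq_single_of_mem i hi, mul_sum]
    · exact sum_congr rfl fun x _ => by ring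
    · intro j hj hji
      simp only [mul_left_comm _ (c j)]
      rw [← mul_sum, horth i hi j hj hji.symm, mul_zero]
  calc
    _ = ∑ i ∈ t, e i * ∑ x ∈ s, u i x ^ 2 := hdiag e
    _ ≤ ∑ i ∈ t, τ * ∑ x ∈ s, u i x ^ 2 := by
      gcongr with i hi
      exact he i hi
    _ = _ := by
      rw [← hdiag fun _ => τ, mul_sum]
      refine sum_congr rfl fun x _ => ?_
      rw [← mul_sum]
      ring

theorem sum_mul_disjointMean_sub_le {k d : ℕ} (hdk : d < k) (hk : 2 * k < Fintype.card α)
    (hd : 2 * k + 2 * d ≤ Fintype.card α + 3) (f : Finset α → ℝ) :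
    ∑ T ∈ univ.powersetCard k, f T * ((Fintype.card α - d) * disjointMean k d f T -
        (Fintype.card α - k) * disjointMean k k f T) ≤
      (k - d) * ∑ T ∈ univ.powersetCard k, f T ^ 2 := by
  obtain ⟨h, hh, hf⟩ := exists_sum_levelSum k f
  have horth : ∀ i ∈ range (k + 1), ∀ j ∈ range (k + 1), i ≠ j →
      ∑ T ∈ univ.powersetCard k, levelSum i (h i) T * levelSum j (h j) T = 0 := by
    intro i hi j hj hij
    rw [mem_range] at hi hj
    rcases hij.lt_or_gt with hlt | hlt
    · exact (hh j).sum_levelSum_mul_levelSum hlt (by omega) (by omega) _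
    · simp only [mul_comm (levelSum i _ _)]
      exact (hh i).sum_levelSum_mul_levelSum hlt (by omega) (by omega) _
  have hle := sum_mul_sum_mul_le_of_orthogonal horth fun i hi =>
    neg_one_pow_mul_kneserRatio_sub_le hdk hk hd (Nat.lt_succ_iff.1 (mem_range.1 hi))
  refine (sum_congr rfl fun T hT => ?_).trans_le (hle.trans_eq ?_)
  · have hTk := mem_powersetCard_univ.1 hT
    rw [hf T hTk, disjointMean_eq_sum hf, disjointMean_eq_sum hf, mul_sum, mul_sum,
      ← sum_sub_distrib]
    congr 1
    refine sum_congr rfl fun i hi => ?_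
    have hik := Nat.lt_succ_iff.1 (mem_range.1 hi)
    rw [(hh i).disjointMean_levelSum hTk hdk.le hik hk.le,
      (hh i).disjointMean_levelSum hTk le_rfl hik hk.le]
    ring
  · congr 1
    exact sum_congr rfl fun T hT => by rw [hf T (mem_powersetCard_univ.1 hT)]

end Decomposition

section Intersecting

open Finset

variable {α : Type*} [Fintype α] [DecidableEq α] {k d : ℕ} {F : Finset (Finset α)}

theorem supersetMean_indicator (hsize : (F : Set (Finset α)).Sized k) {S : Finset α}
    (hS : #S ≤ k) :
    supersetMean k (fun R => if R ∈ F then 1 else 0) S =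
      (#{T ∈ F | S ⊆ T} : ℝ) / (Fintype.card α - #S).choose (k - #S) := by
  rw [supersetMean, expect_eq_sum_div_card,
    card_filter_powersetCard_subset _ _ _ (subset_univ S) hS, card_univ, sum_boole, filter_filter]
  congr 3
  ext T
  simp only [mem_filter, mem_powersetCard_univ]
  exact ⟨fun ⟨_, hST, hT⟩ => ⟨hT, hST⟩, fun ⟨hT, hST⟩ => ⟨hsize hT, hST, hT⟩⟩

theorem disjointMean_indicator_eq_zero (hint : (F : Set (Finset α)).Intersecting) {T : Finset α}
    (hT : T ∈ F) : disjointMean k k (fun R => if R ∈ F then 1 else 0) T = 0 := by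
  refine expect_eq_zero fun S hS => expect_eq_zero fun R hR => if_neg fun hRF => ?_
  obtain ⟨hST, hSk⟩ := mem_powersetCard.1 hS
  obtain ⟨hRk, hSR⟩ := mem_filter.1 hR
  obtain rfl := eq_of_subset_of_card_le hSR ((mem_powersetCard_univ.1 hRk).trans hSk.symm).le
  exact hint hT hRF (disjoint_compl_right.mono_right hST)

theorem exists_disjointMean_indicator_le (hdk : d < k) (hk : 2 * k < Fintype.card α)
    (hd : 2 * k + 2 * d ≤ Fintype.card α + 3) (hF : F.Nonempty)
    (hsize : (F : Set (Finset α)).Sized k) (hint : (F : Set (Finset α)).Intersecting) :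
    ∃ T ∈ F, (Fintype.card α - d) * disjointMean k d (fun R => if R ∈ F then 1 else 0) T ≤
      k - d := by
  have hle := sum_mul_disjointMean_sub_le hdk hk hd fun R => if R ∈ F then 1 else 0
  have hfilter : {T ∈ (univ : Finset α).powersetCard k | T ∈ F} = F := by
    ext T
    simp only [mem_filter, mem_powersetCard_univ, and_iff_right_iff_imp]
    exact fun hT => hsize hT
  simp only [ite_mul, one_mul, zero_mul, ite_pow, one_pow, zero_pow two_ne_zero, ← sum_filter,
    hfilter] at hle
  refine exists_le_of_sum_le hF ?_
  rw [sum_const, nsmul_eq_mul, mul_comm (#F : ℝ)]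
  refine (sum_congr rfl fun T hT => ?_).trans_le (hle.trans_eq ?_)
  · rw [disjointMean_indicator_eq_zero hint hT, mul_zero, sub_zero]
  · rw [sum_const, nsmul_one]

end Intersecting

open Finset in
-- The cases `d = 0` and `d = 1` are the theorems of Erdős–Ko–Rado and of Huang and Zhao.
theorem theorem1_general {α : Type*} [Fintype α] [DecidableEq α] {k d : ℕ} (hdk : d < k)
    (hk : 2 * k < Fintype.card α) (hd : 2 * k + 2 * d ≤ Fintype.card α + 3)
    {F : Finset (Finset α)} (hsize : (F : Set (Finset α)).Sized k)
    (hint : (F : Set (Finset α)).Intersecting) :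
    ∃ S : Finset α, #S = d ∧
      #{T ∈ F | S ⊆ T} ≤ (Fintype.card α - d - 1).choose (k - d - 1) := by
  rcases F.eq_empty_or_nonempty with rfl | hF
  · obtain ⟨S, -, hS⟩ := exists_subset_card_eq (s := (univ : Finset α)) (n := d)
      (by rw [card_univ]; omega)
    exact ⟨S, hS, by simp⟩
  have hnd : (0 : ℝ) < Fintype.card α - d :=
    sub_pos.2 (Nat.cast_lt.2 (by omega : d < Fintype.card α))
  have hchoose : (0 : ℝ) < (Fintype.card α - d).choose (k - d) :=
    Nat.cast_pos.2 (Nat.choose_pos (by omega))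
  obtain ⟨T, hT, hmean⟩ := exists_disjointMean_indicator_le hdk hk hd hF hsize hint
  have hne : (Tᶜ.powersetCard d).Nonempty :=
    powersetCard_nonempty.2 (by rw [card_compl, hsize hT]; omega)
  obtain ⟨S, hS, hdeg⟩ := exists_le_of_expect_le hne ((le_div_iff₀' hnd).2 hmean)
  obtain ⟨-, rfl⟩ := mem_powersetCard.1 hS
  refine ⟨S, rfl, ?_⟩
  rw [supersetMean_indicator hsize hdk.le, div_le_div_iff₀ hchoose hnd, mul_comm (k - #S : ℝ),
    choose_mul_sub hdk (by omega)] at hdeg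
  exact_mod_cast le_of_mul_le_mul_right hdeg hnd

theorem theorem1 (n k d : ℕ) (hd : 2 ≤ d) (hdk : d < k) (hn : 2 * k + 2 * d - 3 ≤ n)
    (F : Finset (Finset (Fin n))) (hsize : (F : Set (Finset (Fin n))).Sized k)
    (hint : (F : Set (Finset (Fin n))).Intersecting) :
    minDegree d F ≤ Nat.choose (n - d - 1) (k - d - 1) := by
  obtain ⟨S, hS, hdeg⟩ := theorem1_general hdk (by rw [Fintype.card_fin]; omega)
    (by rw [Fintype.card_fin]; omega) hsize hint
  rw [Fintype.card_fin] at hdeg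
  exact ((isLeast_minDegree (by omega) F).2 ⟨S, hS, rfl⟩).trans hdeg
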